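/- **Setting.** Fix a finite relational signature $\sigma$ and a set $\Gamma$ of primary key constraints, that is, for every relation symbol $R$ of $\sigma$ a set of columns of $R$, its key. A database $D$ over $\sigma$ is a finite set of facts $R(\bar a)$. Two facts $u,v$ are equivalent, $u\sim v$, if they have the same relation symbol and agree on its key; the equivalence classes of $\sim$ on $D$ are the blocks of $D$, and a repair of $D$ is a subset of $D$ containing exactly one fact of each block. For a repair $r$, a fact $u\in r$ and $v\in D$ with $v\sim u$, let $r[u\to v]=(r\setminus\{u\})\cup\{v\}$. A (Boolean conjunctive) query $q$ is a finite sequence of atoms $A_1,\dots,A_n$, each a relation symbol applied to a tuple of variables; it is self-join-free if its atoms have pairwise different relation symbols. A solution to $q$ in a set of facts $S$ is a sequence $\bar u=(\mu(A_1),\dots,\mu(A_n))$ of facts of $S$, for a map $\mu$ from the variables of $q$ to constants; we write $S\models q(\bar u)$, say that $\mu(A_i)$ matches $A_i$, and write $S\models q$ if there is a solution. The query $q$ is certain for $D$ if $r\models q$ for every repair $r$ of $D$; $\mathrm{certain}(q)$ is the problem of deciding this, given $D$. **The algorithm $C_k(q)$.** On input $D$, let $\Delta_k(q,D)$ be the family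 of sets of at most $k$ facts of $D$ obtained as follows. Initially it contains every such set $S$ with $S\models q$. Then, repeatedly, a set $S$ of at most $k$ facts of $D$ is added if $D$ has a block $B$ such that for every $u\in B$ some $S'\subseteq S\cup\{u\}$ is already in the family. $C_k(q)$ answers "yes" on $D$ if and only if $\emptyset\in\Delta_k(q,D)$. **The condition HP.** Let $\mathrm{vars}(A)$ be the set of variables of an atom $A$ and $\mathrm{key}(A)$ the set of those that occur at a key position. An atom $A'$ of $q$ is determined by an atom $A$ of $q$ if there are atoms $B_1,\dots,B_m=A'$ of $q$, $m\ge 1$, with $\mathrm{key}(B_i)\subseteq \mathrm{vars}(A)\cup\bigcup_{j<i}\mathrm{vars}(B_j)$ for all $i$. A set of atoms is stable if any two of its atoms determine each other. We say that $q$ satisfies HP if the set of atoms of $q$ has an ordered partition $S_1,\dots,S_m$ into nonempty stable sets such that for all $1\le i<m$ and all $A\in S_{i+1}$ the following holds. For every database $D$, every repair $r$ of $D$ and all solutions $\bar\alpha u\bar\beta$ and $\bar\alpha'u'\bar\beta'$ to $q$ in $D$, where $\bar\alpha,\bar\alpha'$ match $S_1\cup\dots\cup S_i$ and $u,u'$ match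 $A$: if $$r\models q(\bar\alpha u\bar\beta),\qquad u\sim u',\qquad r[u\to u']\models q(\bar\alpha'u'\bar\beta'),$$ then there are sequences $\bar\delta,\bar\delta'$ of facts with $$r\models q(\bar\alpha'u\bar\delta)\qquad\text{and}\qquad r[u\to u']\models q(\bar\alpha u'\bar\delta').$$ **Theorem.** Let $q$ be a self-join-free query that does not satisfy HP. Then for every natural number $k$ the algorithm $C_k(q)$ does not compute $\mathrm{certain}(q)$; more precisely, there is a database $D$ such that $q$ is certain for $D$ but $\emptyset\notin\Delta_k(q,D)$. -/

import Mathlib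

namespace CQA

/-- A relational signature: finitely many relation symbols, each with an arity. -/
structure Signature where
  Rel : Type
  finite_rel : Finite Rel
  arity : Rel → ℕ

/-- A set of primary key constraints: one set of key columns for each relation symbol. -/
def KeyConstraints (σ : Signature) : Type :=
  ∀ R : σ.Rel, Set (Fin (σ.arity R))

/-- A term `R(a₁, …, aₘ)`: a relation symbol applied to a tuple of the right length. -/
structure RelTerm (σ : Signature) (V : Type) where
  rel : σ.Rel
  args : Fin (σ.arity rel) → V

/-- Facts are terms over the constants `V` of a database. -/
abbrev Fact (σ : Signature) (V : Type) : Type := RelTerm σ V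

/-- Atoms are terms over the variables `X` of a query. -/
abbrev Atom (σ : Signature) (X : Type) : Type := RelTerm σ X

/-- The term obtained by applying a map to all the entries of a term. -/
def RelTerm.map {σ : Signature} {X V : Type} (μ : X → V) (A : RelTerm σ X) : RelTerm σ V :=
  ⟨A.rel, fun j => μ (A.args j)⟩

/-- A database, viewed as a finite set of facts (its active domain is then finite too). -/
structure Database (σ : Signature) (V : Type) where
  facts : Set (Fact σ V)
  finite_facts : facts.Finite

/-- `Γ`-equivalence: same relation symbol, and agreement on the key columns of that symbol. -/
def KeyEquiv {σ : Signature} {V : Type} (Γ : KeyConstraints σ) (u v : Fact σ V) : Prop :=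
  ∃ h : u.rel = v.rel,
    ∀ j : Fin (σ.arity u.rel), j ∈ Γ u.rel →
      u.args j = v.args (Fin.cast (congrArg σ.arity h) j)

/-- A block of `D`: an equivalence class of the facts of `D` under `Γ`-equivalence. -/
def IsBlock {σ : Signature} {V : Type} (Γ : KeyConstraints σ) (D : Database σ V)
    (B : Set (Fact σ V)) : Prop :=
  ∃ u ∈ D.facts, B = {v | v ∈ D.facts ∧ KeyEquiv Γ u v}

/-- A repair of `D`: a subset of `D` with exactly one fact from each block of `D`. -/
def IsRepair {σ : Signature} {V : Type} (Γ : KeyConstraints σ) (D : Database σ V)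
    (r : Set (Fact σ V)) : Prop :=
  r ⊆ D.facts ∧ ∀ B : Set (Fact σ V), IsBlock Γ D B → ∃! u : Fact σ V, u ∈ B ∧ u ∈ r

/-- `r[u → v]`: the fact `u` is replaced by the fact `v`. -/
def replaceFact {σ : Signature} {V : Type} (r : Set (Fact σ V)) (u v : Fact σ V) :
    Set (Fact σ V) :=
  insert v (r \ {u})

/-- A Boolean conjunctive query: a finite sequence of atoms. The type `Var` is exactly the set
of variables of the query, that is, each of them occurs in some atom. -/
structure Query (σ : Signature) where
  Var : Type
  n : ℕ
  atom : Fin n → Atom σ Var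
  occurs : ∀ x : Var, ∃ (i : Fin n) (j : Fin (σ.arity (atom i).rel)), (atom i).args j = x

namespace Query

variable {σ : Signature}

/-- All atoms of the query have different relation symbols. -/
def SelfJoinFree (q : Query σ) : Prop :=
  Function.Injective fun i : Fin q.n => (q.atom i).rel

/-- `S ⊨ q(u)`: the sequence of facts `u`, all from `S`, is the image of the sequence of atoms
of `q` under some valuation of the variables. -/
def IsSolution (q : Query σ) {V : Type} (S : Set (Fact σ V)) (u : Fin q.n → Fact σ V) : Prop :=
  ∃ μ : q.Var → V, ∀ i : Fin q.n, u i = (q.atom i).map μ ∧ u i ∈ S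

/-- `S ⊨ q`. -/
def Satisfied (q : Query σ) {V : Type} (S : Set (Fact σ V)) : Prop :=
  ∃ u : Fin q.n → Fact σ V, q.IsSolution S u

/-- `q` is certain for `D`: all repairs of `D` satisfy `q`. -/
def Certain (q : Query σ) (Γ : KeyConstraints σ) {V : Type} (D : Database σ V) : Prop :=
  ∀ r : Set (Fact σ V), IsRepair Γ D r → q.Satisfied r

/-- A `k`-set over `D`: a set of at most `k` facts of `D`. -/
def IsKSet (k : ℕ) {V : Type} (D : Database σ V) (S : Set (Fact σ V)) : Prop :=
  S ⊆ D.facts ∧ S.ncard ≤ k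

/-- The family of `k`-sets computed by the algorithm after `t` iterations. Initially these are
the `k`-sets that satisfy `q`. Then a `k`-set `S` is added as soon as `D` has a block `B` such
that, for all `u ∈ B`, some subset of `S ∪ {u}` is already present. -/
def deltaStage (q : Query σ) (Γ : KeyConstraints σ) (k : ℕ) {V : Type} (D : Database σ V) :
    ℕ → Set (Set (Fact σ V))
  | 0 => {S | IsKSet k D S ∧ q.Satisfied S}
  | t + 1 => deltaStage q Γ k D t ∪
      {S | IsKSet k D S ∧ ∃ B : Set (Fact σ V), IsBlock Γ D B ∧
        ∀ u ∈ B, ∃ S' ∈ deltaStage q Γ k D t, S' ⊆ insert u S}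

/-- `Δₖ(q, D)`: all the `k`-sets that are derived eventually. -/
def delta (q : Query σ) (Γ : KeyConstraints σ) (k : ℕ) {V : Type} (D : Database σ V) :
    Set (Set (Fact σ V)) :=
  ⋃ t : ℕ, q.deltaStage Γ k D t

/-- `D ⊨ Cₖ(q)`: the algorithm answers yes, that is, the empty set is derived. -/
def CqkAccepts (q : Query σ) (Γ : KeyConstraints σ) (k : ℕ) {V : Type} (D : Database σ V) :
    Prop :=
  (∅ : Set (Fact σ V)) ∈ q.delta Γ k D

/-- `Cₖ(q)` computes `certain(q)`: on each database, it answers yes iff `q` is certain. -/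
def CqkComputesCertain (q : Query σ) (Γ : KeyConstraints σ) (k : ℕ) : Prop :=
  ∀ (V : Type) (D : Database σ V), q.CqkAccepts Γ k D ↔ q.Certain Γ D

/-- The variables of the `i`-th atom. -/
def varsOf (q : Query σ) (i : Fin q.n) : Set q.Var :=
  Set.range (q.atom i).args

/-- The variables of the `i`-th atom that occur at a key position. -/
def keyOf (q : Query σ) (Γ : KeyConstraints σ) (i : Fin q.n) : Set q.Var :=
  (q.atom i).args '' Γ (q.atom i).rel

/-- `X A₁ … Aₙ` is a `Γ`-derivation: the key variables of each `Aᵢ` are in `X` or occur in one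
of the atoms before `Aᵢ` (`X` accumulates the variables of the atoms already passed). -/
def IsDerivation (q : Query σ) (Γ : KeyConstraints σ) : Set q.Var → List (Fin q.n) → Prop
  | _, [] => True
  | X, A :: L => q.keyOf Γ A ⊆ X ∧ IsDerivation q Γ (X ∪ q.varsOf A) L

/-- The atom `A'` is `Γ`-determined by the atom `A`: there is a `Γ`-derivation
`vars(A) A₁ … Aₘ` whose last atom `Aₘ` is `A'`. -/
def Determined (q : Query σ) (Γ : KeyConstraints σ) (A A' : Fin q.n) : Prop :=
  ∃ L : List (Fin q.n), q.IsDerivation Γ (q.varsOf A) (L ++ [A'])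

/-- A set of atoms is stable if its atoms are pairwise mutually `Γ`-determined. -/
def IsStable (q : Query σ) (Γ : KeyConstraints σ) (S : Set (Fin q.n)) : Prop :=
  ∀ A ∈ S, ∀ A' ∈ S, q.Determined Γ A A' ∧ q.Determined Γ A' A

/-- A `Γ`-sequence: a sequence of stable sets that form a partition of the atoms of `q`. -/
structure IsGammaSequence (q : Query σ) (Γ : KeyConstraints σ) {m : ℕ}
    (τ : Fin m → Set (Fin q.n)) : Prop where
  stable : ∀ i, q.IsStable Γ (τ i)
  nonempty : ∀ i, (τ i).Nonempty
  disjoint : ∀ i j, i ≠ j → Disjoint (τ i) (τ j)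
  cover : ⋃ i, τ i = Set.univ

/-- The exchange condition for a set `P` of atoms and an atom `A`. The solutions
`w = ᾱ u β̄` and `w' = ᾱ' u' β̄'` have `ᾱ`, `ᾱ'` as their restrictions to `P`, and `u = w A`,
`u' = w' A`. -/
def ExchangeAt (q : Query σ) (Γ : KeyConstraints σ) (P : Set (Fin q.n)) (A : Fin q.n) : Prop :=
  ∀ (V : Type) (D : Database σ V) (r : Set (Fact σ V)) (w w' : Fin q.n → Fact σ V),
    IsRepair Γ D r → q.IsSolution D.facts w → q.IsSolution D.facts w' →
    q.IsSolution r w → KeyEquiv Γ (w A) (w' A) →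
    q.IsSolution (replaceFact r (w A) (w' A)) w' →
    (∃ v : Fin q.n → Fact σ V,
      q.IsSolution r v ∧ (∀ j ∈ P, v j = w' j) ∧ v A = w A) ∧
    (∃ v' : Fin q.n → Fact σ V,
      q.IsSolution (replaceFact r (w A) (w' A)) v' ∧ (∀ j ∈ P, v' j = w j) ∧ v' A = w' A)

/-- `q ⊨ HP_τ`: with `τ = S₁ … Sₘ`, the exchange condition holds for `P = S₁ ∪ … ∪ Sᵢ` and each
atom `A` of `Sᵢ₊₁`, for `1 ≤ i < m`. Here the sets are numbered from `0`. -/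
def HPSeq (q : Query σ) (Γ : KeyConstraints σ) {m : ℕ} (τ : Fin m → Set (Fin q.n)) : Prop :=
  ∀ i : Fin m, 0 < (i : ℕ) → ∀ A ∈ τ i, q.ExchangeAt Γ {B | ∃ j : Fin m, j < i ∧ B ∈ τ j} A

/-- `q ⊨ HP`. -/
def HP (q : Query σ) (Γ : KeyConstraints σ) : Prop :=
  ∃ (m : ℕ) (τ : Fin m → Set (Fin q.n)), q.IsGammaSequence Γ τ ∧ q.HPSeq Γ τ

end Query

end CQA

namespace CQA

/-! ### Terms, key equivalence and repairs -/

section Terms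

variable {σ : Signature} {X V : Type}

/-! Everything rests on the attack graph. Write A⁺ for `plus A`; an atom A attacks B if a chain of
variables outside A⁺, consecutive ones sharing an atom, leads from A to B.

Suppose that whenever F and G attack each other, vars(F) determines key(G). Then HP holds
(`HP.of_weak_attacks`): by `Attacks.trans_or` longer attack cycles reduce to cycles of length two,
so the strongly connected components are stable, and in topological order no atom attacks an earlier
component. This suffices for the exchange condition (`exchangeAt_of_not_attacks`): its two solutions
agree on A⁺, so one of them can be used on the variables reached from A and the other one elsewhere.

Hence the failure of HP yields F and G attacking each other such that vars(F) does not determine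
key(G). This is enough room to encode N + 1 pigeons and N holes. A block of F is a pigeon choosing a
hole; a block of G is a hole with a pair of pigeons, choosing one of the pair; a solution is a
pigeon lying in a hole for which G has chosen it. Two pigeons must share a hole, so the query is
certain (`certain_pigeonDatabase`). Fewer than N facts cannot reveal this: a partial injective
assignment that avoids the choices of G extends into every block (`PigeonGood.exists_insert`). -/

theorem RelTerm.map_eq_map_iff {A : RelTerm σ X} {μ ν : X → V} :
    A.map μ = A.map ν ↔ ∀ j, μ (A.args j) = ν (A.args j) := by
  simp [RelTerm.map, funext_iff]

theorem keyEquiv_map_iff (Γ : KeyConstraints σ) {A : RelTerm σ X} {μ ν : X → V} :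
    KeyEquiv Γ (A.map μ) (A.map ν) ↔ ∀ j ∈ Γ A.rel, μ (A.args j) = ν (A.args j) :=
  ⟨fun ⟨_, h⟩ => h, fun h => ⟨rfl, h⟩⟩

theorem KeyEquiv.refl (Γ : KeyConstraints σ) (u : Fact σ V) : KeyEquiv Γ u u :=
  ⟨rfl, fun _ _ => rfl⟩

theorem IsRepair.eq_of_keyEquiv {Γ : KeyConstraints σ} {D : Database σ V} {r : Set (Fact σ V)}
    (hr : IsRepair Γ D r) {u v : Fact σ V} (hu : u ∈ r) (hv : v ∈ r) (h : KeyEquiv Γ u v) :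
    u = v :=
  (hr.2 _ ⟨u, hr.1 hu, rfl⟩).unique ⟨⟨hr.1 hu, KeyEquiv.refl Γ u⟩, hu⟩ ⟨⟨hr.1 hv, h⟩, hv⟩

theorem IsRepair.exists_keyEquiv {Γ : KeyConstraints σ} {D : Database σ V} {r : Set (Fact σ V)}
    (hr : IsRepair Γ D r) {u : Fact σ V} (hu : u ∈ D.facts) : ∃ v ∈ r, KeyEquiv Γ u v := by
  obtain ⟨v, ⟨⟨_, h⟩, hv⟩, _⟩ := hr.2 _ ⟨u, hu, rfl⟩
  exact ⟨v, hv, h⟩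

end Terms

namespace Query

variable {σ : Signature} (q : Query σ) (Γ : KeyConstraints σ)

/-! ### Closures and the attack graph -/

/-- The closure of a set of variables under the functional dependencies `key(C) → vars(C)` of the
atoms `C` in `E`. -/
inductive FDClosure (E : Set (Fin q.n)) (X : Set q.Var) : Set q.Var
  | base {x : q.Var} (hx : x ∈ X) : FDClosure E X x
  | step {x : q.Var} (C : Fin q.n) (hC : C ∈ E) (hk : ∀ y ∈ q.keyOf Γ C, FDClosure E X y)
      (hx : x ∈ q.varsOf C) : FDClosure E X x

/-- The closure of `key(A)` under the functional dependencies of the atoms other than `A`. -/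
def plus (A : Fin q.n) : Set q.Var :=
  q.FDClosure Γ {A}ᶜ (q.keyOf Γ A)

/-- The variables that can be reached from `vars(A)` outside `plus A`, where a step leads from a
variable to another one in the same atom. -/
inductive Reach (A : Fin q.n) : q.Var → Prop
  | base {x : q.Var} (hx : x ∈ q.varsOf A) (hp : x ∉ q.plus Γ A) : Reach A x
  | step {x y : q.Var} (C : Fin q.n) (h : Reach A x) (hx : x ∈ q.varsOf C) (hy : y ∈ q.varsOf C)
      (hp : y ∉ q.plus Γ A) : Reach A y

/-- The edges of the attack graph. -/
def Attacks (A B : Fin q.n) : Prop :=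
  ∃ x ∈ q.varsOf B, q.Reach Γ A x

/-- All the key variables of `B` are functionally determined by the variables of `A`. -/
def Implies (A B : Fin q.n) : Prop :=
  q.keyOf Γ B ⊆ q.FDClosure Γ Set.univ (q.varsOf A)

variable {q Γ}

theorem keyOf_subset_varsOf (A : Fin q.n) : q.keyOf Γ A ⊆ q.varsOf A :=
  Set.image_subset_range _ _

theorem FDClosure.varsOf_subset {E : Set (Fin q.n)} {X : Set q.Var} {C : Fin q.n} (hC : C ∈ E)
    (hk : q.keyOf Γ C ⊆ q.FDClosure Γ E X) : q.varsOf C ⊆ q.FDClosure Γ E X :=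
  fun _ hx => FDClosure.step C hC hk hx

theorem FDClosure.subset_of_closed {E : Set (Fin q.n)} {X Y : Set q.Var} (hX : X ⊆ Y)
    (hY : ∀ C ∈ E, q.keyOf Γ C ⊆ Y → q.varsOf C ⊆ Y) : q.FDClosure Γ E X ⊆ Y := by
  intro x hx
  induction hx with
  | base hx => exact hX hx
  | step C hC _ hx ih => exact hY C hC ih hx

theorem keyOf_subset_plus (A : Fin q.n) : q.keyOf Γ A ⊆ q.plus Γ A :=
  fun _ hx => .base hx

theorem varsOf_subset_plus {A C : Fin q.n} (h : C ≠ A) (hk : q.keyOf Γ C ⊆ q.plus Γ A) :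
    q.varsOf C ⊆ q.plus Γ A :=
  FDClosure.varsOf_subset h hk

theorem plus_subset_FDClosure (A : Fin q.n) :
    q.plus Γ A ⊆ q.FDClosure Γ Set.univ (q.varsOf A) :=
  FDClosure.subset_of_closed (fun _ hx => .base (keyOf_subset_varsOf A hx))
    fun _ _ hk => FDClosure.varsOf_subset (Set.mem_univ _) hk

/-! ### From closures to derivations -/

section Derivations

theorem IsDerivation.mono {X Y : Set q.Var} (h : X ⊆ Y) {L : List (Fin q.n)}
    (hL : q.IsDerivation Γ X L) : q.IsDerivation Γ Y L := by
  induction L generalizing X Y with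
  | nil => trivial
  | cons A L ih => exact ⟨hL.1.trans h, ih (Set.union_subset_union_left _ h) hL.2⟩

theorem isDerivation_append {X : Set q.Var} {L L' : List (Fin q.n)} :
    q.IsDerivation Γ X (L ++ L') ↔
      q.IsDerivation Γ X L ∧ q.IsDerivation Γ (X ∪ ⋃ A ∈ L, q.varsOf A) L' := by
  induction L generalizing X with
  | nil => simp [IsDerivation]
  | cons A L ih => simp [IsDerivation, ih, and_assoc, Set.union_assoc]

/-- Derivations from the same set can be concatenated, since enlarging the starting set keeps a
derivation valid. -/
theorem exists_isDerivation_of_finite {X Y : Set q.Var} (hY : Y.Finite)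
    (h : ∀ y ∈ Y, ∃ L, q.IsDerivation Γ X L ∧ y ∈ X ∪ ⋃ A ∈ L, q.varsOf A) :
    ∃ L, q.IsDerivation Γ X L ∧ Y ⊆ X ∪ ⋃ A ∈ L, q.varsOf A := by
  induction Y, hY using Set.Finite.induction_on with
  | empty => exact ⟨[], trivial, Set.empty_subset _⟩
  | @insert y Y _ _ ih =>
    obtain ⟨L, hL, hYL⟩ := ih fun z hz => h z (Set.mem_insert_of_mem _ hz)
    obtain ⟨L', hL', hyL⟩ := h y (Set.mem_insert _ _)
    refine ⟨L ++ L', isDerivation_append.2 ⟨hL, hL'.mono Set.subset_union_left⟩, ?_⟩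
    rintro z (rfl | hz)
    · rcases hyL with hyL | hyL
      · exact .inl hyL
      · simp only [Set.mem_iUnion] at hyL
        obtain ⟨A, hA, hzA⟩ := hyL
        exact .inr (Set.mem_iUnion₂.2 ⟨A, by simp [hA], hzA⟩)
    · rcases hYL hz with hyL | hyL
      · exact .inl hyL
      · simp only [Set.mem_iUnion] at hyL
        obtain ⟨A, hA, hzA⟩ := hyL
        exact .inr (Set.mem_iUnion₂.2 ⟨A, by simp [hA], hzA⟩)

theorem FDClosure.exists_isDerivation {X : Set q.Var} {x : q.Var}
    (hx : x ∈ q.FDClosure Γ Set.univ X) :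
    ∃ L, q.IsDerivation Γ X L ∧ x ∈ X ∪ ⋃ A ∈ L, q.varsOf A := by
  induction hx with
  | base hx => exact ⟨[], trivial, .inl hx⟩
  | step C _ _ hx ih =>
    obtain ⟨L, hL, hC⟩ := exists_isDerivation_of_finite ((Set.toFinite _).image _) ih
    refine ⟨L ++ [C], isDerivation_append.2 ⟨hL, hC, trivial⟩, .inr ?_⟩
    exact Set.mem_iUnion₂.2 ⟨C, by simp, hx⟩

theorem Implies.determined {A B : Fin q.n} (h : q.Implies Γ A B) : q.Determined Γ A B := by
  obtain ⟨L, hL, hB⟩ := exists_isDerivation_of_finite ((Set.toFinite _).image _)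
    fun y hy => FDClosure.exists_isDerivation (h hy)
  exact ⟨L, isDerivation_append.2 ⟨hL, hB, trivial⟩⟩

end Derivations

/-! ### Cycles of the attack graph -/

section AttackGraph

theorem Implies.refl (A : Fin q.n) : q.Implies Γ A A :=
  fun _ hx => .base (keyOf_subset_varsOf A hx)

theorem Implies.trans {A B C : Fin q.n} (h : q.Implies Γ A B) (h' : q.Implies Γ B C) :
    q.Implies Γ A C :=
  Set.Subset.trans h' <| FDClosure.subset_of_closed (FDClosure.varsOf_subset (Set.mem_univ B) h)
    fun _ hC hk => FDClosure.varsOf_subset hC hk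

theorem Reach.notMem_plus {A : Fin q.n} {x : q.Var} (h : q.Reach Γ A x) : x ∉ q.plus Γ A := by
  cases h <;> assumption

theorem Attacks.not_varsOf_subset {A B : Fin q.n} (h : q.Attacks Γ A B) :
    ¬ q.varsOf B ⊆ q.plus Γ A :=
  fun hB => let ⟨_, hx, hr⟩ := h; hr.notMem_plus (hB hx)

theorem Attacks.not_keyOf_subset {A B : Fin q.n} (h : q.Attacks Γ A B) (hne : B ≠ A) :
    ¬ q.keyOf Γ B ⊆ q.plus Γ A :=
  fun hB => h.not_varsOf_subset (varsOf_subset_plus hne hB)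

/-- Trace the derivation of `x` from key(A) backwards. The atom `C` that yields `x` is not `B`, as
vars(B) is not inside A⁺; since `x` is outside B⁺, so is some key variable of `C`, and `B` reaches
it through `C`. The descent ends in key(A). -/
theorem Attacks.of_reach_of_mem_plus {A B : Fin q.n} (h : q.Attacks Γ A B) {x : q.Var}
    (hx : x ∈ q.plus Γ A) (hr : q.Reach Γ B x) : q.Attacks Γ B A := by
  induction hx with
  | base hx => exact ⟨_, keyOf_subset_varsOf A hx, hr⟩
  | @step x C hC hk hx ih =>
    have hCB : C ≠ B := by
      rintro rfl
      exact h.not_varsOf_subset (varsOf_subset_plus hC hk)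
    obtain ⟨y, hy, hyB⟩ : ∃ y ∈ q.keyOf Γ C, y ∉ q.plus Γ B := by
      by_contra! hall
      exact hr.notMem_plus (varsOf_subset_plus hCB hall hx)
    exact ih y hy (.step C hr hx (keyOf_subset_varsOf C hy) hyB)

/-- If `A` attacks `B` and `B` attacks `C`, then `A` attacks `C` or `B` attacks `A`. -/
theorem Attacks.trans_or {A B C : Fin q.n} (hAB : q.Attacks Γ A B) (hBC : q.Attacks Γ B C) :
    q.Attacks Γ A C ∨ q.Attacks Γ B A := by
  by_contra! hcon
  -- As `B` does not attack `A`, no variable reached from `B` lies in A⁺, so a path from `B`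
  -- prolongs one from `A` to `B`.
  have key : ∀ x, q.Reach Γ B x → q.Reach Γ A x := by
    intro x hx
    have hp : x ∉ q.plus Γ A := fun hp => hcon.2 (hAB.of_reach_of_mem_plus hp hx)
    induction hx with
    | base hx hp' =>
      obtain ⟨y, hy, hr⟩ := hAB
      exact .step B hr hy hx hp
    | step D h hx hy hp' ih =>
      exact .step D (ih fun hp => hcon.2 (hAB.of_reach_of_mem_plus hp h)) hx hy hp
  obtain ⟨x, hx, hr⟩ := hBC
  exact hcon.1 ⟨x, hx, key x hr⟩

/-- Induction on the path from `C` back to `A`: either `B` attacks the successor of `C` and the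
cycle gets shorter, or `B` and `C` attack each other. In the latter case `A` and `B` also form a
2-cycle, or `A` attacks `C` and `B` can be skipped. -/
theorem implies_of_attack_cycle_aux
    (hweak : ∀ A B, q.Attacks Γ A B → q.Attacks Γ B A → q.Implies Γ A B) {A C : Fin q.n}
    (hCA : Relation.ReflTransGen (q.Attacks Γ) C A) :
    ∀ B, q.Attacks Γ B C → q.Attacks Γ A B → q.Implies Γ A B := by
  induction hCA using Relation.ReflTransGen.head_induction_on with
  | refl => exact fun B hBA hAB => hweak A B hAB hBA
  | head hCD _ ih =>
    intro B hBC hAB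
    rcases hBC.trans_or hCD with hBD | hCB
    · exact ih B hBD hAB
    · rcases hAB.trans_or hBC with hAC | hBA
      · exact (ih _ hCD hAC).trans (hweak _ _ hCB hBC)
      · exact hweak A B hAB hBA

/-- If all the attack cycles of length two are weak, then so are all attack cycles. -/
theorem implies_of_attack_cycle
    (hweak : ∀ A B, q.Attacks Γ A B → q.Attacks Γ B A → q.Implies Γ A B) {A B : Fin q.n}
    (hAB : q.Attacks Γ A B) (hBA : Relation.ReflTransGen (q.Attacks Γ) B A) :
    q.Implies Γ A B := by
  rcases hBA.cases_head with rfl | ⟨C, hBC, hCA⟩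
  · exact Implies.refl _
  · exact implies_of_attack_cycle_aux hweak hCA B hBC hAB

end AttackGraph

/-! ### Exchanging solutions along attacks -/

section Exchange

theorem SelfJoinFree.eq_of_map_eq (hq : q.SelfJoinFree) {V : Type} {A C : Fin q.n}
    {μ ν : q.Var → V} (h : (q.atom C).map μ = (q.atom A).map ν) : C = A := by
  have hrel := congrArg RelTerm.rel h
  exact hq hrel

theorem SelfJoinFree.map_ne (hq : q.SelfJoinFree) {V : Type} {A C : Fin q.n} (h : C ≠ A)
    (μ ν : q.Var → V) : (q.atom C).map μ ≠ (q.atom A).map ν :=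
  fun e => h (hq.eq_of_map_eq e)

/-- A repair satisfies the key dependencies, so agreement on key(A) propagates through all the atoms
other than `A`. -/
theorem eqOn_plus {V : Type} {r : Set (Fact σ V)} {D : Database σ V} (hr : IsRepair Γ D r)
    {A : Fin q.n} {μ ν : q.Var → V} (hμ : ∀ C ≠ A, (q.atom C).map μ ∈ r)
    (hν : ∀ C ≠ A, (q.atom C).map ν ∈ r)
    (hA : KeyEquiv Γ ((q.atom A).map μ) ((q.atom A).map ν)) {x : q.Var} (hx : x ∈ q.plus Γ A) :
    μ x = ν x := by
  refine FDClosure.subset_of_closed (Y := {x | μ x = ν x}) ?_ ?_ hx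
  · rintro _ ⟨j, hj, rfl⟩
    exact (keyEquiv_map_iff Γ).1 hA j hj
  · rintro C hC hk _ ⟨j, rfl⟩
    refine RelTerm.map_eq_map_iff.1 (hr.eq_of_keyEquiv (hμ C hC) (hν C hC) ?_) j
    exact (keyEquiv_map_iff Γ).2 fun j hj => hk ⟨j, hj, rfl⟩

open Classical in
/-- Two valuations that agree on `plus A` can be mixed along the attacks of `A`. -/
theorem exists_mixed_valuation {V : Type} {A : Fin q.n} {μ ν : q.Var → V}
    (h : ∀ x ∈ q.plus Γ A, μ x = ν x) :
    ∃ κ : q.Var → V, (q.atom A).map κ = (q.atom A).map μ ∧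
      (∀ C, (q.atom C).map κ = (q.atom C).map μ ∨ (q.atom C).map κ = (q.atom C).map ν) ∧
      ∀ C, ¬ q.Attacks Γ A C → (q.atom C).map κ = (q.atom C).map ν := by
  have hν : ∀ C, ¬ q.Attacks Γ A C → (q.atom C).map (fun x => if q.Reach Γ A x then μ x else ν x)
      = (q.atom C).map ν := by
    intro C hC
    refine RelTerm.map_eq_map_iff.2 fun j => if_neg fun hr => hC ⟨_, ⟨j, rfl⟩, hr⟩
  refine ⟨fun x => if q.Reach Γ A x then μ x else ν x, ?_, fun C => ?_, hν⟩
  · refine RelTerm.map_eq_map_iff.2 fun j => ?_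
    split_ifs with hr
    · rfl
    · by_contra hne
      exact hr (.base ⟨j, rfl⟩ fun hp => hne (h _ hp).symm)
  -- In an attacked atom each variable is either reached or in A⁺, where the valuations agree; so
  -- the whole atom follows `μ`.
  · by_cases hC : q.Attacks Γ A C
    · obtain ⟨x, hx, hr⟩ := hC
      refine .inl (RelTerm.map_eq_map_iff.2 fun j => ?_)
      split_ifs with hr'
      · rfl
      · by_contra hne
        exact hr' (.step C hr hx ⟨j, rfl⟩ fun hp => hne (h _ hp).symm)
    · exact .inr (hν C hC)

/-- The exchange condition holds at `A` if `A` attacks none of the atoms of `P`. -/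
theorem exchangeAt_of_not_attacks (hq : q.SelfJoinFree) {P : Set (Fin q.n)} {A : Fin q.n}
    (hP : ∀ C ∈ P, ¬ q.Attacks Γ A C) : q.ExchangeAt Γ P A := by
  rintro V D r w w' hr - - ⟨μ, hμ⟩ hA ⟨ν, hν⟩
  obtain rfl : w = fun i => (q.atom i).map μ := funext fun i => (hμ i).1
  obtain rfl : w' = fun i => (q.atom i).map ν := funext fun i => (hν i).1
  have hμr : ∀ C, (q.atom C).map μ ∈ r := fun C => (hμ C).2
  have hνr : ∀ C ≠ A, (q.atom C).map ν ∈ r := fun C hC =>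
    ((hν C).2.resolve_left (hq.map_ne hC _ _)).1
  have hpl : ∀ x ∈ q.plus Γ A, μ x = ν x := fun x =>
    eqOn_plus hr (fun C _ => hμr C) hνr hA
  constructor
  · obtain ⟨κ, hκA, hκ, hκP⟩ := exists_mixed_valuation hpl
    refine ⟨fun i => (q.atom i).map κ, ⟨κ, fun i => ⟨rfl, ?_⟩⟩, fun j hj => hκP j (hP j hj), hκA⟩
    by_cases hi : i = A
    · subst hi
      exact Set.mem_of_eq_of_mem hκA (hμr i)
    · rcases hκ i with h | h
      · exact Set.mem_of_eq_of_mem h (hμr i)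
      · exact Set.mem_of_eq_of_mem h (hνr i hi)
  -- The same mixture with the roles of `μ` and `ν` exchanged.
  · obtain ⟨κ, hκA, hκ, hκP⟩ := exists_mixed_valuation fun x hx => (hpl x hx).symm
    refine ⟨fun i => (q.atom i).map κ, ⟨κ, fun i => ⟨rfl, ?_⟩⟩, fun j hj => hκP j (hP j hj), hκA⟩
    by_cases hi : i = A
    · subst hi
      exact .inl hκA
    · refine .inr ⟨?_, hq.map_ne hi _ _⟩
      rcases hκ i with h | h
      · exact Set.mem_of_eq_of_mem h (hνr i hi)
      · exact Set.mem_of_eq_of_mem h (hμr i)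

end Exchange

/-! ### Ordering the components, and HP -/

/-- Every finite preorder maps monotonically onto an initial segment of the naturals so that the
fibres are the classes of equivalent elements. -/
theorem exists_monotone_fin {α : Type} [Finite α] [Preorder α] :
    ∃ (m : ℕ) (f : α → Fin m), f.Surjective ∧ Monotone f ∧ ∀ a b, f a = f b → a ≤ b := by
  have : Finite (Antisymmetrization α (· ≤ ·)) := Quotient.finite _
  have := Fintype.ofFinite (Antisymmetrization α (· ≤ ·))
  have : Fintype (LinearExtension (Antisymmetrization α (· ≤ ·))) := this
  let e := Fintype.orderIsoFinOfCardEq (LinearExtension (Antisymmetrization α (· ≤ ·))) rfl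
  refine ⟨_, fun a => e.symm (toLinearExtension (toAntisymmetrization (· ≤ ·) a)), ?_, ?_, ?_⟩
  · intro i
    obtain ⟨a, ha⟩ := Quotient.exists_rep (s := AntisymmRel.setoid α (· ≤ ·)) (e i)
    exact ⟨a, (e.symm_apply_eq).2 ha⟩
  · intro a b hab
    exact e.symm.monotone (toLinearExtension.monotone (toAntisymmetrization_mono hab))
  · intro a b hab
    exact (Quotient.exact (s := AntisymmRel.setoid α (· ≤ ·)) (e.symm.injective hab)).1

/-- A query whose attack cycles of length two are all weak satisfies HP. -/
theorem HP.of_weak_attacks (hq : q.SelfJoinFree)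
    (hweak : ∀ A B, q.Attacks Γ A B → q.Attacks Γ B A → q.Implies Γ A B) : q.HP Γ := by
  obtain ⟨m, f, hsurj, hmono, hfib⟩ := @exists_monotone_fin (Fin q.n) _
    { le := Relation.ReflTransGen (q.Attacks Γ)
      lt := fun A B => Relation.ReflTransGen (q.Attacks Γ) A B ∧
        ¬ Relation.ReflTransGen (q.Attacks Γ) B A
      lt_iff_le_not_ge := fun _ _ => Iff.rfl
      le_refl := fun _ => .refl
      le_trans := fun _ _ _ => .trans }
  have himp : ∀ A B, f A = f B → q.Implies Γ A B := by
    suffices H : ∀ A B, Relation.ReflTransGen (q.Attacks Γ) A B →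
        Relation.ReflTransGen (q.Attacks Γ) B A → q.Implies Γ A B from
      fun A B h => H A B (hfib A B h) (hfib B A h.symm)
    intro A B hAB hBA
    induction hAB with
    | refl => exact .refl A
    | tail hAC hCB ih =>
      exact (ih (.head hCB hBA)).trans (implies_of_attack_cycle hweak hCB (hBA.trans hAC))
  refine ⟨m, fun i => f ⁻¹' {i}, ⟨?_, ?_, ?_, ?_⟩, ?_⟩
  · rintro i A rfl B hB
    exact ⟨(himp _ _ (Eq.symm hB)).determined, (himp _ _ hB).determined⟩
  · exact hsurj
  · intro i j hij
    exact Set.disjoint_left.2 fun A hA hA' => hij (hA.symm.trans hA')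
  · ext A
    simp
  · rintro i - A rfl
    -- Attacks never decrease `f`, so `A` attacks nothing in an earlier class.
    refine exchangeAt_of_not_attacks hq ?_
    rintro C ⟨_, hlt, rfl⟩ hAC
    exact absurd (hmono (Relation.ReflTransGen.single hAC)) (not_le.2 hlt)

/-! ### Refuting the algorithm -/

/-- Certificate that `Cₖ` answers no: a downward closed family of sets of facts that contains `∅`,
whose members do not satisfy `q`, and from which each `k`-set can be extended into each block. -/
theorem not_cqkAccepts_of_good {V : Type} {D : Database σ V} {k : ℕ}
    (good : Set (Fact σ V) → Prop) (hempty : good ∅)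
    (hmono : ∀ S S', S' ⊆ S → good S → good S') (hsat : ∀ S, good S → ¬ q.Satisfied S)
    (hext : ∀ S, good S → IsKSet k D S → ∀ B, IsBlock Γ D B → ∃ u ∈ B, good (insert u S)) :
    ¬ q.CqkAccepts Γ k D := by
  have key : ∀ t, ∀ S ∈ q.deltaStage Γ k D t, ¬ good S := by
    intro t
    induction t with
    | zero => exact fun S hS hg => hsat S hg hS.2
    | succ t ih =>
      rintro S (hS | ⟨hS, B, hB, h⟩) hg
      · exact ih S hS hg
      · obtain ⟨u, hu, hgu⟩ := hext S hg hS B hB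
        obtain ⟨S', hS', hsub⟩ := h u hu
        exact ih S' hS' (hmono _ _ hsub hgu)
  intro h
  obtain ⟨t, ht⟩ := Set.mem_iUnion.1 h
  exact key t ∅ ht hempty

/-! ### The pigeonhole database -/

section Pigeonhole

/-- The indices of the pigeonhole gadget with `N` holes: a pigeon, a hole and a pair of pigeons. -/
abbrev PigeonIndex (N : ℕ) : Type :=
  Fin (N + 1) × Fin N × Fin (N + 1) × Fin (N + 1)

/-- The pigeon is one of the two distinct pigeons of the pair. -/
def PigeonIndex.Valid {N : ℕ} (t : PigeonIndex N) : Prop :=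
  t.2.2.1 ≠ t.2.2.2 ∧ (t.1 = t.2.2.1 ∨ t.1 = t.2.2.2)

/-- The constants of the pigeonhole database. -/
abbrev PigeonConst (N : ℕ) : Type :=
  Option (Fin (N + 1)) × Option (Fin N) × Option (Fin (N + 1) × Fin (N + 1))

variable (q Γ)

open Classical in
/-- The valuation where a variable carries the pigeon unless it is in `plus G`, the hole unless it
is in `plus F`, and the pair unless it is determined by `F`. -/
noncomputable def pigeonVal (F G : Fin q.n) {N : ℕ} (t : PigeonIndex N) (x : q.Var) : PigeonConst N :=
  (if x ∈ q.plus Γ G then none else some t.1,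
    if x ∈ q.plus Γ F then none else some t.2.1,
    if x ∈ q.FDClosure Γ Set.univ (q.varsOf F) then none else some t.2.2)

/-- The image of the `i`-th atom under `pigeonVal`. -/
noncomputable def pigeonFact (F G : Fin q.n) {N : ℕ} (t : PigeonIndex N) (i : Fin q.n) :
    Fact σ (PigeonConst N) :=
  (q.atom i).map (q.pigeonVal Γ F G t)

/-- The database of all `pigeonFact`s for valid indices. -/
noncomputable def pigeonDatabase (F G : Fin q.n) (N : ℕ) : Database σ (PigeonConst N) where
  facts := {f | ∃ t : PigeonIndex N, t.Valid ∧ ∃ i, f = q.pigeonFact Γ F G t i}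
  finite_facts := (Set.finite_range fun p : PigeonIndex N × Fin q.n =>
    q.pigeonFact Γ F G p.1 p.2).subset fun _ ⟨t, _, i, h⟩ => ⟨(t, i), h.symm⟩

variable {q Γ} {F G : Fin q.n} {N : ℕ} {t t' : PigeonIndex N}

theorem SelfJoinFree.eq_of_pigeonFact (hq : q.SelfJoinFree) {i j : Fin q.n}
    (h : KeyEquiv Γ (q.pigeonFact Γ F G t i) (q.pigeonFact Γ F G t' j)) : i = j :=
  hq h.1

theorem pigeonVal_eq_iff {x : q.Var} : q.pigeonVal Γ F G t x = q.pigeonVal Γ F G t' x ↔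
    (x ∉ q.plus Γ G → t.1 = t'.1) ∧ (x ∉ q.plus Γ F → t.2.1 = t'.2.1) ∧
    (x ∉ q.FDClosure Γ Set.univ (q.varsOf F) → t.2.2 = t'.2.2) := by
  simp only [pigeonVal, Prod.ext_iff (x := (_, _, _)), Prod.ext_iff (x := (_, _))]
  refine and_congr ?_ (and_congr ?_ ?_)
  all_goals split_ifs with h <;> simp [h, Prod.ext_iff]

/-- Agreement of two valuations on a set of variables. -/
theorem forall_pigeonVal_eq_iff {Y : Set q.Var} :
    (∀ x ∈ Y, q.pigeonVal Γ F G t x = q.pigeonVal Γ F G t' x) ↔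
    (¬ Y ⊆ q.plus Γ G → t.1 = t'.1) ∧ (¬ Y ⊆ q.plus Γ F → t.2.1 = t'.2.1) ∧
    (¬ Y ⊆ q.FDClosure Γ Set.univ (q.varsOf F) → t.2.2 = t'.2.2) := by
  simp only [pigeonVal_eq_iff, Set.not_subset]
  exact ⟨fun h => ⟨fun ⟨x, hx, hn⟩ => (h x hx).1 hn, fun ⟨x, hx, hn⟩ => (h x hx).2.1 hn,
    fun ⟨x, hx, hn⟩ => (h x hx).2.2 hn⟩, fun h x hx => ⟨fun hn => h.1 ⟨x, hx, hn⟩,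
    fun hn => h.2.1 ⟨x, hx, hn⟩, fun hn => h.2.2 ⟨x, hx, hn⟩⟩⟩

theorem keyEquiv_pigeonFact_iff {i : Fin q.n} :
    KeyEquiv Γ (q.pigeonFact Γ F G t i) (q.pigeonFact Γ F G t' i) ↔
    ∀ x ∈ q.keyOf Γ i, q.pigeonVal Γ F G t x = q.pigeonVal Γ F G t' x :=
  (keyEquiv_map_iff Γ).trans ⟨fun h _ ⟨j, hj, hx⟩ => hx ▸ h j hj, fun h j hj => h _ ⟨j, hj, rfl⟩⟩

theorem pigeonFact_eq_iff {i : Fin q.n} :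
    q.pigeonFact Γ F G t i = q.pigeonFact Γ F G t' i ↔
    ∀ x ∈ q.varsOf i, q.pigeonVal Γ F G t x = q.pigeonVal Γ F G t' x :=
  RelTerm.map_eq_map_iff.trans ⟨fun h _ ⟨j, hx⟩ => hx ▸ h j, fun h j => h _ ⟨j, rfl⟩⟩

/-- Each of the three sets that hide a coordinate is closed under key(i) → vars(i). Hence only `F`
and `G` offer a choice to a repair. -/
theorem pigeonFact_eq_of_keyEquiv {i : Fin q.n} (hF : i ≠ F) (hG : i ≠ G)
    (h : KeyEquiv Γ (q.pigeonFact Γ F G t i) (q.pigeonFact Γ F G t' i)) :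
    q.pigeonFact Γ F G t i = q.pigeonFact Γ F G t' i := by
  rw [keyEquiv_pigeonFact_iff, forall_pigeonVal_eq_iff] at h
  rw [pigeonFact_eq_iff, forall_pigeonVal_eq_iff]
  exact ⟨fun hn => h.1 fun hk => hn (varsOf_subset_plus hG hk),
    fun hn => h.2.1 fun hk => hn (varsOf_subset_plus hF hk),
    fun hn => h.2.2 fun hk => hn (FDClosure.varsOf_subset (Set.mem_univ i) hk)⟩

theorem Attacks.keyEquiv_pigeonFact_left (hne : F ≠ G) (hGF : q.Attacks Γ G F) :
    KeyEquiv Γ (q.pigeonFact Γ F G t F) (q.pigeonFact Γ F G t' F) ↔ t.1 = t'.1 := by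
  rw [keyEquiv_pigeonFact_iff, forall_pigeonVal_eq_iff]
  refine ⟨fun h => h.1 (hGF.not_keyOf_subset hne), fun h => ⟨fun _ => h, fun hn => ?_, fun hn => ?_⟩⟩
  · exact absurd (keyOf_subset_plus F) hn
  · exact absurd ((keyOf_subset_plus F).trans (plus_subset_FDClosure F)) hn

theorem Attacks.not_varsOf_self_subset {A B : Fin q.n} (h : q.Attacks Γ A B) :
    ¬ q.varsOf A ⊆ q.plus Γ A := by
  obtain ⟨x, hxB, hr⟩ := h
  clear hxB
  induction hr with
  | base hx hp => exact fun hs => hp (hs hx)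
  | step _ _ _ _ _ ih => exact ih

theorem Attacks.pigeonFact_left_eq_iff (hFG : q.Attacks Γ F G) (hGF : q.Attacks Γ G F) :
    q.pigeonFact Γ F G t F = q.pigeonFact Γ F G t' F ↔ t.1 = t'.1 ∧ t.2.1 = t'.2.1 := by
  rw [pigeonFact_eq_iff, forall_pigeonVal_eq_iff]
  refine ⟨fun h => ⟨h.1 hGF.not_varsOf_subset, h.2.1 hFG.not_varsOf_self_subset⟩,
    fun h => ⟨fun _ => h.1, fun _ => h.2, fun hn => absurd (fun x hx => .base hx) hn⟩⟩

theorem Attacks.keyEquiv_pigeonFact_right (hne : F ≠ G) (hFG : q.Attacks Γ F G)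
    (hw : ¬ q.Implies Γ F G) :
    KeyEquiv Γ (q.pigeonFact Γ F G t G) (q.pigeonFact Γ F G t' G) ↔ t.2 = t'.2 := by
  rw [keyEquiv_pigeonFact_iff, forall_pigeonVal_eq_iff]
  refine ⟨fun h => Prod.ext (h.2.1 (hFG.not_keyOf_subset hne.symm)) (h.2.2 hw),
    fun h => ⟨fun hn => absurd (keyOf_subset_plus G) hn, fun _ => h ▸ rfl, fun _ => h ▸ rfl⟩⟩

/-- A value carried by the variables outside `plus A` propagates along the attacks of `A`. -/
theorem Attacks.eq_of_carried {A B : Fin q.n} (h : q.Attacks Γ A B) {β : Type}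
    {φ : q.Var → Option β} {τ : Fin q.n → β}
    (hφ : ∀ i, ∀ x ∈ q.varsOf i, x ∉ q.plus Γ A → φ x = some (τ i)) : τ A = τ B := by
  obtain ⟨x, hxB, hr⟩ := h
  suffices H : φ x = some (τ A) from
    Option.some.inj (H.symm.trans (hφ B x hxB hr.notMem_plus))
  clear hxB
  induction hr with
  | base hx hp => exact hφ A _ hx hp
  | step C h hx hy hp ih =>
    rw [hφ C _ hy hp, ← ih, hφ C _ hx h.notMem_plus]

/-- A set is good if it fixes an injective partial assignment of holes to pigeons which respects
the exclusions given by its facts for `G`. -/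
def PigeonGood (q : Query σ) (Γ : KeyConstraints σ) (F G : Fin q.n) (N : ℕ)
    (S : Set (Fact σ (PigeonConst N))) : Prop :=
  ∀ t t' : PigeonIndex N, t.2.1 = t'.2.1 → q.pigeonFact Γ F G t F ∈ S →
    (q.pigeonFact Γ F G t' F ∈ S → t.1 = t'.1) ∧ (q.pigeonFact Γ F G t' G ∈ S → t.1 ≠ t'.1)

/-- The attack of `F` on `G` transports the hole and the attack of `G` on `F` the pigeon, so in a
solution the facts for `F` and `G` share both, which goodness excludes. -/
theorem PigeonGood.not_satisfied (hq : q.SelfJoinFree) (hFG : q.Attacks Γ F G)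
    (hGF : q.Attacks Γ G F) {S : Set (Fact σ (PigeonConst N))} (hg : q.PigeonGood Γ F G N S)
    (hS : S ⊆ (q.pigeonDatabase Γ F G N).facts) : ¬ q.Satisfied S := by
  rintro ⟨u, μ, hu⟩
  have hex : ∀ i, ∃ t : PigeonIndex N, (q.atom i).map μ = q.pigeonFact Γ F G t i := by
    intro i
    obtain ⟨t, _, j, h⟩ := hS (hu i).2
    have h' := (hu i).1.symm.trans h
    obtain rfl : i = j := hq.eq_of_map_eq h'
    exact ⟨t, h'⟩
  choose t ht using hex
  have hval : ∀ i, ∀ x ∈ q.varsOf i, μ x = q.pigeonVal Γ F G (t i) x := by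
    rintro i _ ⟨j, rfl⟩
    exact RelTerm.map_eq_map_iff.1 (ht i) j
  have hhole : (t F).2.1 = (t G).2.1 :=
    hFG.eq_of_carried (φ := fun x => (μ x).2.1) (τ := fun i => (t i).2.1) fun i x hx hp => by
      simp [hval i x hx, pigeonVal, hp]
  have hpigeon : (t G).1 = (t F).1 :=
    hGF.eq_of_carried (φ := fun x => (μ x).1) (τ := fun i => (t i).1) fun i x hx hp => by
      simp [hval i x hx, pigeonVal, hp]
  have hmem : ∀ i, q.pigeonFact Γ F G (t i) i ∈ S := fun i => ht i ▸ (hu i).1 ▸ (hu i).2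
  exact (hg _ _ hhole (hmem F)).2 (hmem G) hpigeon.symm

theorem certain_pigeonDatabase (hq : q.SelfJoinFree) (hFG : q.Attacks Γ F G)
    (hGF : q.Attacks Γ G F) (hw : ¬ q.Implies Γ F G) (hN : 0 < N) :
    q.Certain Γ (q.pigeonDatabase Γ F G N) := by
  have hne : F ≠ G := fun h => hw (h ▸ .refl F)
  intro r hr
  have hmem : ∀ (t : PigeonIndex N) (i : Fin q.n), t.Valid → ∃ t' : PigeonIndex N, t'.Valid ∧
      q.pigeonFact Γ F G t' i ∈ r ∧
      KeyEquiv Γ (q.pigeonFact Γ F G t i) (q.pigeonFact Γ F G t' i) := by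
    intro t i ht
    obtain ⟨v, hv, h⟩ := hr.exists_keyEquiv (show q.pigeonFact Γ F G t i ∈
      (q.pigeonDatabase Γ F G N).facts from ⟨t, ht, i, rfl⟩)
    obtain ⟨t', ht', j, rfl⟩ := hr.1 hv
    obtain rfl := hq.eq_of_pigeonFact h
    exact ⟨t', ht', hv, h⟩
  -- The facts for `F` do not carry the pair, so the chosen hole serves all `c`; `p'` and hole `0`
  -- only make up a valid index that names the block.
  have hhole : ∀ p : Fin (N + 1), ∃ h : Fin N, ∀ c,
      q.pigeonFact Γ F G (p, h, c) F ∈ r := by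
    intro p
    obtain ⟨p', hp'⟩ : ∃ p', p ≠ p' := by
      have : Nontrivial (Fin (N + 1)) := Fin.nontrivial_iff_two_le.2 (by omega)
      exact (exists_ne p).imp fun _ h => h.symm
    obtain ⟨t, -, htr, hk⟩ := hmem (p, ⟨0, hN⟩, p, p') F ⟨hp', .inl rfl⟩
    refine ⟨t.2.1, fun c => ?_⟩
    rwa [(hFG.pigeonFact_left_eq_iff hGF).2
      (⟨(hGF.keyEquiv_pigeonFact_left hne).1 hk, rfl⟩ : p = t.1 ∧ t.2.1 = t.2.1)]
  choose f hf using hhole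
  obtain ⟨p, p', hpp, hfp⟩ := Fintype.exists_ne_map_eq_of_card_lt f (by simp)
  -- Whichever of the colliding pigeons this block of `G` selects, that pigeon sits in the hole `f
  -- p`.
  obtain ⟨⟨a, c⟩, ht, htr, hk⟩ := hmem (p, f p, p, p') G ⟨hpp, .inl rfl⟩
  obtain rfl : (f p, p, p') = c := (hFG.keyEquiv_pigeonFact_right hne hw).1 hk
  refine ⟨_, q.pigeonVal Γ F G (a, f p, p, p'), fun i => ⟨rfl, ?_⟩⟩
  change q.pigeonFact Γ F G _ i ∈ r
  by_cases hF : i = F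
  · subst hF
    rcases ht.2 with h | h <;> obtain rfl : a = _ := h
    · exact hf _ _
    · exact hfp ▸ hf _ _
  · by_cases hG : i = G
    · exact hG ▸ htr
    · obtain ⟨t', -, ht', hk'⟩ := hmem (a, f p, p, p') i ht
      rwa [pigeonFact_eq_of_keyEquiv hF hG hk']

theorem SelfJoinFree.pigeonFact_mem_insert (hq : q.SelfJoinFree) {i j : Fin q.n} (h : i ≠ j)
    {S : Set (Fact σ (PigeonConst N))} :
    q.pigeonFact Γ F G t i ∈ insert (q.pigeonFact Γ F G t' j) S ↔ q.pigeonFact Γ F G t i ∈ S :=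
  Set.mem_insert_iff.trans (or_iff_right (hq.map_ne h _ _))

/-- A set of fewer than `N` facts leaves some hole unused. -/
theorem exists_free_hole (hq : q.SelfJoinFree) (hFG : q.Attacks Γ F G) (hGF : q.Attacks Γ G F)
    (hw : ¬ q.Implies Γ F G) {S : Set (Fact σ (PigeonConst N))} (hfin : S.Finite)
    (hS : S.ncard < N) : ∃ h : Fin N, ∀ t : PigeonIndex N, t.2.1 = h →
      q.pigeonFact Γ F G t F ∉ S ∧ q.pigeonFact Γ F G t G ∉ S := by
  have hne : F ≠ G := fun h => hw (h ▸ .refl F)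
  by_contra! hcon
  have hex : ∀ h : Fin N, ∃ u : S, ∃ t : PigeonIndex N, t.2.1 = h ∧
      (u.1 = q.pigeonFact Γ F G t F ∨ u.1 = q.pigeonFact Γ F G t G) := by
    intro h
    obtain ⟨t, ht, h'⟩ := hcon h
    by_cases hF : q.pigeonFact Γ F G t F ∈ S
    · exact ⟨⟨_, hF⟩, t, ht, .inl rfl⟩
    · exact ⟨⟨_, h' hF⟩, t, ht, .inr rfl⟩
  choose φ τ hτ hφ using hex
  -- A fact for `F` or `G` carries its hole, so distinct holes use distinct facts.
  have hinj : φ.Injective := by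
    intro h h' heq
    rw [← hτ h, ← hτ h']
    have hu := congrArg Subtype.val heq
    rcases hφ h with h1 | h1 <;> rcases hφ h' with h2 | h2 <;> rw [h1, h2] at hu
    · exact ((hFG.pigeonFact_left_eq_iff hGF).1 hu).2
    · exact absurd hu (hq.map_ne hne _ _)
    · exact absurd hu (hq.map_ne hne.symm _ _)
    · exact congrArg Prod.fst
        ((hFG.keyEquiv_pigeonFact_right hne hw).1 (hu ▸ KeyEquiv.refl Γ _))
  have : Finite S := hfin
  have hcard := Nat.card_le_card_of_injective φ hinj
  rw [Nat.card_fin, Nat.card_coe_set_eq] at hcard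
  omega

theorem PigeonGood.exists_insert (hq : q.SelfJoinFree) (hFG : q.Attacks Γ F G)
    (hGF : q.Attacks Γ G F) (hw : ¬ q.Implies Γ F G) {S : Set (Fact σ (PigeonConst N))}
    (hg : q.PigeonGood Γ F G N S) (hfin : S.Finite) (hS : S.ncard < N) (ht : t.Valid)
    (i : Fin q.n) : ∃ t' : PigeonIndex N, t'.Valid ∧
      KeyEquiv Γ (q.pigeonFact Γ F G t i) (q.pigeonFact Γ F G t' i) ∧
      q.PigeonGood Γ F G N (insert (q.pigeonFact Γ F G t' i) S) := by
  have hne : F ≠ G := fun h => hw (h ▸ .refl F)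
  by_cases hF : i = F
  · subst hF
    obtain ⟨h, hh⟩ := exists_free_hole hq hFG hGF hw hfin hS
    refine ⟨(t.1, h, t.2.2), ht, (hGF.keyEquiv_pigeonFact_left hne).2 rfl, ?_⟩
    intro s s' hss hs
    rw [hq.pigeonFact_mem_insert hne.symm]
    rw [Set.mem_insert_iff, hFG.pigeonFact_left_eq_iff hGF] at hs ⊢
    rcases hs with ⟨hs, hsh⟩ | hs
    · have hs' := hh s' (hss.symm.trans hsh)
      exact ⟨fun h' => h'.elim (fun h' => hs.trans h'.1.symm) fun h' => absurd h' hs'.1,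
        fun h' => absurd h' hs'.2⟩
    · refine ⟨fun h' => h'.elim (fun h' => ?_) (hg s s' hss hs).1, (hg s s' hss hs).2⟩
      exact absurd hs (hh s (hss.trans h'.2)).1
  by_cases hG : i = G
  · subst hG
    -- By injectivity `S` puts at most one pigeon into this hole, so one member of the pair is safe
    -- to choose.
    obtain ⟨a, hva, ha⟩ : ∃ a, PigeonIndex.Valid (a, t.2) ∧ ∀ s : PigeonIndex N,
        s.2.1 = t.2.1 → q.pigeonFact Γ F i s F ∈ S → s.1 ≠ a := by
      by_cases hp : ∃ s : PigeonIndex N, s.2.1 = t.2.1 ∧ q.pigeonFact Γ F i s F ∈ S ∧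
          s.1 = t.2.2.1
      · obtain ⟨s, hs, hsS, hs1⟩ := hp
        refine ⟨t.2.2.2, ⟨ht.1, .inr rfl⟩, fun s' hs' hsS' h => ht.1 ?_⟩
        rw [← hs1, ← h]
        exact (hg s s' (hs.trans hs'.symm) hsS).1 hsS'
      · exact ⟨t.2.2.1, ⟨ht.1, .inl rfl⟩, fun s hs hsS h => hp ⟨s, hs, hsS, h⟩⟩
    refine ⟨(a, t.2), hva, (hFG.keyEquiv_pigeonFact_right hne hw).2 rfl, ?_⟩
    intro s s' hss hs
    rw [hq.pigeonFact_mem_insert hne] at hs ⊢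
    refine ⟨(hg s s' hss hs).1, fun h => ?_⟩
    rcases Set.mem_insert_iff.1 h with h | h
    · have h1 : s'.1 = a :=
        (forall_pigeonVal_eq_iff.1 (pigeonFact_eq_iff.1 h)).1 hGF.not_varsOf_self_subset
      have h2 : s'.2 = t.2 :=
        (hFG.keyEquiv_pigeonFact_right (t' := (a, t.2)) hne hw).1 (h ▸ KeyEquiv.refl Γ _)
      exact h1 ▸ ha s (hss.trans (congrArg Prod.fst h2)) hs
    · exact (hg s s' hss hs).2 h
  · refine ⟨t, ht, .refl Γ _, fun s s' hss hs => ?_⟩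
    rw [hq.pigeonFact_mem_insert (Ne.symm hF)] at hs ⊢
    rw [hq.pigeonFact_mem_insert (Ne.symm hG)]
    exact hg s s' hss hs

theorem not_cqkAccepts_pigeonDatabase (hq : q.SelfJoinFree) (hFG : q.Attacks Γ F G)
    (hGF : q.Attacks Γ G F) (hw : ¬ q.Implies Γ F G) {k : ℕ} (hk : k < N) :
    ¬ q.CqkAccepts Γ k (q.pigeonDatabase Γ F G N) := by
  refine not_cqkAccepts_of_good
    (fun S => S ⊆ (q.pigeonDatabase Γ F G N).facts ∧ q.PigeonGood Γ F G N S) ?_ ?_ ?_ ?_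
  · exact ⟨Set.empty_subset _, fun _ _ _ h => absurd h (Set.notMem_empty _)⟩
  · exact fun S S' h ⟨hS, hg⟩ => ⟨h.trans hS, fun t t' htt ht =>
      ⟨fun h' => (hg t t' htt (h ht)).1 (h h'), fun h' => (hg t t' htt (h ht)).2 (h h')⟩⟩
  · exact fun S ⟨hS, hg⟩ => hg.not_satisfied hq hFG hGF hS
  · rintro S ⟨hS, hg⟩ hkS B ⟨_, ⟨t, ht, i, rfl⟩, rfl⟩
    obtain ⟨t', ht', hkey, hg'⟩ := hg.exists_insert hq hFG hGF hw
      ((q.pigeonDatabase Γ F G N).finite_facts.subset hS) (hkS.2.trans_lt hk) ht i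
    have hmem : q.pigeonFact Γ F G t' i ∈ (q.pigeonDatabase Γ F G N).facts := ⟨t', ht', i, rfl⟩
    exact ⟨_, ⟨hmem, hkey⟩, Set.insert_subset hmem hS, hg'⟩

end Pigeonhole

end Query

end CQA

theorem mainTheorem2 (σ : CQA.Signature) (Γ : CQA.KeyConstraints σ) (q : CQA.Query σ)
    (hsjf : q.SelfJoinFree) (hHP : ¬ q.HP Γ) (k : ℕ) :
    ¬ q.CqkComputesCertain Γ k ∧
      ∃ (V : Type) (D : CQA.Database σ V),
        q.Certain Γ D ∧ (∅ : Set (CQA.Fact σ V)) ∉ q.delta Γ k D := by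
  suffices H : ∃ (V : Type) (D : CQA.Database σ V), q.Certain Γ D ∧ ¬ q.CqkAccepts Γ k D from
    ⟨fun h => let ⟨V, D, hc, ha⟩ := H; ha ((h V D).2 hc), H⟩
  obtain ⟨F, G, hFG, hGF, hw⟩ :
      ∃ F G, q.Attacks Γ F G ∧ q.Attacks Γ G F ∧ ¬ q.Implies Γ F G := by
    by_contra! hweak
    exact hHP (CQA.Query.HP.of_weak_attacks hsjf hweak)
  -- With `k + 1` holes, a `k`-set always leaves one of them free.
  exact ⟨_, q.pigeonDatabase Γ F G (k + 1),
    CQA.Query.certain_pigeonDatabase hsjf hFG hGF hw k.succ_pos,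
    CQA.Query.not_cqkAccepts_pigeonDatabase hsjf hFG hGF hw k.lt_succ_self⟩
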